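/- Let $\mathbb F$ be a field, $\mathbb K$ a field extension of $\mathbb F$, $N\ge n\ge 1$, and let $z_1,\dots,z_N$ be indeterminates; put $z=(z_1,\dots,z_n)$ and $w=(z_1,\dots,z_N)$, so that $\mathbb F(z)\subseteq\mathbb K(w)$. A linear matrix pencil over $\mathbb F[z]$ is a square matrix of the form $A(z)=A_0+z_1A_1+\cdots+z_nA_n$ with $A_0,\dots,A_n\in\mathbb F^{m\times m}$; it is called symmetric if all $A_j$ ($0\le j\le n$) are symmetric, and homogeneous if $A_0=0$. A matrix $F(z)\in\mathbb F(z)^{k\times k}$ has a Bessmertnyĭ realization (BR) over $\mathbb F(z)$ if there is a linear matrix pencil $A(z)$ over $\mathbb F[z]$, partitioned into a $2\times2$ block matrix $A(z)=[A_{ij}(z)]_{i,j=1,2}$ with square diagonal blocks and with $A_{22}(z)$ (of size at least $1$) invertible over $\mathbb F(z)$, such that $$F(z)=A_{11}(z)-A_{12}(z)A_{22}(z)^{-1}A_{21}(z).$$ It has a symmetric (SBR), homogeneous (hBR), or homogeneous symmetric (hSBR) Bessmertnyĭ realization over $\mathbb F(z)$ if $A(z)$ can be chosen symmetric, homogeneous,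 or both homogeneous and symmetric, respectively. The same notions over $\mathbb K(w)$ are defined by replacing $\mathbb F$ by $\mathbb K$ and $z$ by $w$. **Theorem.** Let $F(z)\in\mathbb F(z)^{k\times k}$. If $F(z)$, viewed as a matrix over $\mathbb K(w)$, has a BR, SBR, hBR, or hSBR over $\mathbb K(w)$, then it has a BR, SBR, hBR, or hSBR, respectively, over $\mathbb F(z)$. -/

import Mathlib

noncomputable section

namespace Bessmertnyi

/-- The field `F(z)` of rational functions in `z = (z₁, …, zₙ)` over `F`. -/
abbrev RatFun (n : ℕ) (F : Type*) [Field F] : Type _ :=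
  FractionRing (MvPolynomial (Fin n) F)

section Pencils

variable {F : Type*} [Field F] {n : ℕ} {ι : Type*}

/-- The matrix polynomial `A₀ + z₁ A₁ + ⋯ + zₙ Aₙ` with coefficients `A₀` and `A = (A₁, …, Aₙ)`. -/
def pencil (A₀ : Matrix ι ι F) (A : Fin n → Matrix ι ι F) :
    Matrix ι ι (MvPolynomial (Fin n) F) :=
  A₀.map MvPolynomial.C +
    ∑ i, (MvPolynomial.X i : MvPolynomial (Fin n) F) • (A i).map MvPolynomial.C

/-- (Affine) linear matrix pencil. -/
def IsLP (P : Matrix ι ι (MvPolynomial (Fin n) F)) : Prop :=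
  ∃ (A₀ : Matrix ι ι F) (A : Fin n → Matrix ι ι F), P = pencil A₀ A

/-- Linear symmetric matrix pencil: all coefficients are symmetric. -/
def IsSLP (P : Matrix ι ι (MvPolynomial (Fin n) F)) : Prop :=
  ∃ (A₀ : Matrix ι ι F) (A : Fin n → Matrix ι ι F),
    A₀.IsSymm ∧ (∀ i, (A i).IsSymm) ∧ P = pencil A₀ A

/-- Linear homogeneous matrix pencil: `A₀ = 0`. -/
def IsHLP (P : Matrix ι ι (MvPolynomial (Fin n) F)) : Prop :=
  ∃ A : Fin n → Matrix ι ι F, P = pencil 0 A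

/-- Linear homogeneous symmetric matrix pencil: `A₀ = 0` and all coefficients are symmetric. -/
def IsHSLP (P : Matrix ι ι (MvPolynomial (Fin n) F)) : Prop :=
  ∃ A : Fin n → Matrix ι ι F, (∀ i, (A i).IsSymm) ∧ P = pencil 0 A

end Pencils

section Realizations

variable {F : Type*} [Field F] {n k : ℕ}

/-- The polynomial matrix `P`, partitioned into `2 × 2` block form with diagonal blocks of sizes
`k` and `p`, has a block `P₂₂` which is invertible over `F(z)`, and
`R = P₁₁ - P₁₂ P₂₂⁻¹ P₂₁` is the Schur complement of `P` with respect to `P₂₂`. -/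
def IsSchurComplement {p : ℕ}
    (P : Matrix (Fin k ⊕ Fin p) (Fin k ⊕ Fin p) (MvPolynomial (Fin n) F))
    (R : Matrix (Fin k) (Fin k) (RatFun n F)) : Prop :=
  let Q : Matrix (Fin k ⊕ Fin p) (Fin k ⊕ Fin p) (RatFun n F) :=
    P.map (algebraMap (MvPolynomial (Fin n) F) (RatFun n F))
  IsUnit Q.toBlocks₂₂ ∧ R = Q.toBlocks₁₁ - Q.toBlocks₁₂ * Q.toBlocks₂₂⁻¹ * Q.toBlocks₂₁

/-- `R` has a Bessmertnyĭ realization (BR) over `F(z)`. -/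
def HasBR (R : Matrix (Fin k) (Fin k) (RatFun n F)) : Prop :=
  ∃ p : ℕ, 0 < p ∧
    ∃ P : Matrix (Fin k ⊕ Fin p) (Fin k ⊕ Fin p) (MvPolynomial (Fin n) F),
      IsLP P ∧ IsSchurComplement P R

/-- `R` has a symmetric Bessmertnyĭ realization (SBR) over `F(z)`. -/
def HasSBR (R : Matrix (Fin k) (Fin k) (RatFun n F)) : Prop :=
  ∃ p : ℕ, 0 < p ∧
    ∃ P : Matrix (Fin k ⊕ Fin p) (Fin k ⊕ Fin p) (MvPolynomial (Fin n) F),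
      IsSLP P ∧ IsSchurComplement P R

/-- `R` has a homogeneous Bessmertnyĭ realization (hBR) over `F(z)`. -/
def HasHBR (R : Matrix (Fin k) (Fin k) (RatFun n F)) : Prop :=
  ∃ p : ℕ, 0 < p ∧
    ∃ P : Matrix (Fin k ⊕ Fin p) (Fin k ⊕ Fin p) (MvPolynomial (Fin n) F),
      IsHLP P ∧ IsSchurComplement P R

/-- `R` has a homogeneous symmetric Bessmertnyĭ realization (hSBR) over `F(z)`. -/
def HasHSBR (R : Matrix (Fin k) (Fin k) (RatFun n F)) : Prop :=
  ∃ p : ℕ, 0 < p ∧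
    ∃ P : Matrix (Fin k ⊕ Fin p) (Fin k ⊕ Fin p) (MvPolynomial (Fin n) F),
      IsHSLP P ∧ IsSchurComplement P R

end Realizations

section Extension

variable (F K : Type*) [Field F] [Field K] [Algebra F K] {n N : ℕ} (h : n ≤ N)

/-- The inclusion `F[z₁, …, zₙ] ⊆ K[z₁, …, z_N]` for `n ≤ N`. -/
def polyIncl : MvPolynomial (Fin n) F →+* MvPolynomial (Fin N) K :=
  (MvPolynomial.rename (R := K) (Fin.castLE h)).toRingHom.comp
    (MvPolynomial.map (algebraMap F K))

theorem polyIncl_injective : Function.Injective (polyIncl F K h) :=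
  (MvPolynomial.rename_injective (R := K) _ (Fin.castLE_injective h)).comp
    (MvPolynomial.map_injective _ (algebraMap F K).injective)

/-- The inclusion `F(z₁, …, zₙ) ⊆ K(z₁, …, z_N)` for `n ≤ N`. -/
def ratIncl : RatFun n F →+* RatFun N K :=
  IsFractionRing.map (polyIncl_injective F K h)

end Extension

end Bessmertnyi

end

/-! Write R = q⁻¹P with P, q over F[z] and clear denominators: a realization is then a pencil with
det B₂₂ ≠ 0 satisfying a polynomial identity (`SchurIdentity`), which moves along ring
homomorphisms. The coefficients descend from K[w] to F in three moves, each preserving symmetry and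
homogeneity.

Extra variables: each z_j with j > n is replaced by (z_j/z₁)z₁, with z_j/z₁ a scalar of E = K(w).
This fixes F[z] and sends homogeneous pencils to homogeneous pencils in z over E; it needs n ≥ 1.

Finiteness (`HasPolyRealization.exists_finite`): the coefficients lie in a finitely generated
F-algebra, whose quotient by a maximal ideal is a finite extension of F by Zariski's lemma.

Finite extensions (`HasPolyRealization.descend`): take an F-linear l : E → F with l(1) = 1 and read
M as the bilinear form l(xᵀMy) on Fᵏ ⊕ Eᵖ over F. Since (x, y) ↦ l(xy) is nondegenerate, eliminating
Eᵖ gives l of the Schur complement of M, which is R because R is defined over F. -/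

noncomputable section

namespace Bessmertnyi

open Matrix

/-! ### Pencils over commutative rings -/

section LinearPencil

variable {S T ι κ : Type*} [CommRing S] [CommRing T] {n : ℕ}

/-- The pencil `A₀ + z₁ A₁ + ⋯ + zₙ Aₙ` with coefficients in a commutative ring. -/
def linearPencil (A₀ : Matrix ι ι S) (A : Fin n → Matrix ι ι S) :
    Matrix ι ι (MvPolynomial (Fin n) S) :=
  A₀.map MvPolynomial.C +
    ∑ i, (MvPolynomial.X i : MvPolynomial (Fin n) S) • (A i).map MvPolynomial.C

theorem linearPencil_apply (A₀ : Matrix ι ι S) (A : Fin n → Matrix ι ι S) (x y : ι) :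
    linearPencil A₀ A x y =
      MvPolynomial.C (A₀ x y) + ∑ i, MvPolynomial.X i * MvPolynomial.C (A i x y) := by
  simp [linearPencil, Matrix.sum_apply]

theorem linearPencil_map (f : S →+* T) (A₀ : Matrix ι ι S) (A : Fin n → Matrix ι ι S) :
    (linearPencil A₀ A).map (MvPolynomial.map f) =
      linearPencil (A₀.map f) (fun i => (A i).map f) := by
  ext1 x y
  simp [linearPencil_apply]

theorem linearPencil_submatrix (e : κ → ι) (A₀ : Matrix ι ι S) (A : Fin n → Matrix ι ι S) :
    (linearPencil A₀ A).submatrix e e =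
      linearPencil (A₀.submatrix e e) (fun i => (A i).submatrix e e) := by
  ext1 x y
  simp [linearPencil_apply]

/-- The conditions on the coefficients of a pencil: symmetric if `s`, homogeneous if `h`. -/
def CoeffCond (s h : Prop) (A₀ : Matrix ι ι S) (A : Fin n → Matrix ι ι S) : Prop :=
  (s → A₀.IsSymm ∧ ∀ i, (A i).IsSymm) ∧ (h → A₀ = 0)

theorem CoeffCond.map {s h : Prop} {A₀ : Matrix ι ι S} {A : Fin n → Matrix ι ι S}
    (H : CoeffCond s h A₀ A) (f : S →+* T) :
    CoeffCond s h (A₀.map f) (fun i => (A i).map f) := by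
  refine ⟨fun hs => ⟨(H.1 hs).1.map f, fun i => ((H.1 hs).2 i).map f⟩, fun hh => ?_⟩
  rw [H.2 hh]
  ext
  simp

theorem CoeffCond.submatrix {s h : Prop} {A₀ : Matrix ι ι S} {A : Fin n → Matrix ι ι S}
    (H : CoeffCond s h A₀ A) (e : κ → ι) :
    CoeffCond s h (A₀.submatrix e e) (fun i => (A i).submatrix e e) := by
  refine ⟨fun hs => ⟨(H.1 hs).1.submatrix e, fun i => ((H.1 hs).2 i).submatrix e⟩, fun hh => ?_⟩
  rw [H.2 hh]
  rfl

end LinearPencil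

/-! ### Schur complements without denominators -/

section SchurIdentity

variable {T T' κ κ' : Type*} [CommRing T] [CommRing T'] [Fintype κ] [DecidableEq κ]
  [Fintype κ'] [DecidableEq κ'] {k : ℕ}

/-- The denominator-free form of `q⁻¹ P = B₁₁ - B₁₂ B₂₂⁻¹ B₂₁`. -/
def SchurIdentity (B : Matrix (Fin k ⊕ κ) (Fin k ⊕ κ) T) (P : Matrix (Fin k) (Fin k) T)
    (q : T) : Prop :=
  B.toBlocks₂₂.det • P =
    q • (B.toBlocks₂₂.det • B.toBlocks₁₁ - B.toBlocks₁₂ * B.toBlocks₂₂.adjugate * B.toBlocks₂₁)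

theorem det_toBlocks₂₂_map (f : T →+* T') (B : Matrix (Fin k ⊕ κ) (Fin k ⊕ κ) T) :
    (B.map f).toBlocks₂₂.det = f B.toBlocks₂₂.det :=
  (f.map_det _).symm

/-- Determinants and adjugates are polynomial in the entries, so they commute with every ring
homomorphism, including quotient maps. -/
theorem schurIdentity_map_iff (f : T →+* T') (B : Matrix (Fin k ⊕ κ) (Fin k ⊕ κ) T)
    (P : Matrix (Fin k) (Fin k) T) (q : T) :
    SchurIdentity (B.map f) (P.map f) (f q) ↔
      (B.toBlocks₂₂.det • P).map f =
        (q • (B.toBlocks₂₂.det • B.toBlocks₁₁ -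
          B.toBlocks₁₂ * B.toBlocks₂₂.adjugate * B.toBlocks₂₁)).map f := by
  have h1 : (B.map f).toBlocks₂₂.adjugate = B.toBlocks₂₂.adjugate.map f :=
    (f.map_adjugate _).symm
  have h2 : (B.map f).toBlocks₁₂ * B.toBlocks₂₂.adjugate.map f * (B.map f).toBlocks₂₁ =
      (B.toBlocks₁₂ * B.toBlocks₂₂.adjugate * B.toBlocks₂₁).map f := by
    rw [Matrix.map_mul, Matrix.map_mul]
    rfl
  unfold SchurIdentity
  rw [det_toBlocks₂₂_map, h1, h2]
  simp only [← Matrix.ext_iff, Matrix.smul_apply, Matrix.sub_apply, Matrix.map_apply,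
    Matrix.toBlocks₁₁, Matrix.of_apply, smul_eq_mul, map_mul, map_sub]

theorem SchurIdentity.map {B : Matrix (Fin k ⊕ κ) (Fin k ⊕ κ) T}
    {P : Matrix (Fin k) (Fin k) T} {q : T} (H : SchurIdentity B P q) (f : T →+* T') :
    SchurIdentity (B.map f) (P.map f) (f q) :=
  (schurIdentity_map_iff f B P q).2 (congrArg (fun M => M.map f) H)

theorem SchurIdentity.of_map {f : T →+* T'} (hf : Function.Injective f)
    {B : Matrix (Fin k ⊕ κ) (Fin k ⊕ κ) T} {P : Matrix (Fin k) (Fin k) T} {q : T}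
    (H : SchurIdentity (B.map f) (P.map f) (f q)) : SchurIdentity B P q :=
  Matrix.map_injective hf ((schurIdentity_map_iff f B P q).1 H)

theorem SchurIdentity.reindex {B : Matrix (Fin k ⊕ κ) (Fin k ⊕ κ) T}
    {P : Matrix (Fin k) (Fin k) T} {q : T} (H : SchurIdentity B P q) (e : κ' ≃ κ) :
    SchurIdentity (B.submatrix (Sum.map id e) (Sum.map id e)) P q := by
  have h22 : (B.submatrix (Sum.map id e) (Sum.map id e)).toBlocks₂₂ =
    B.toBlocks₂₂.submatrix e e := rfl
  have h12 : (B.submatrix (Sum.map id e) (Sum.map id e)).toBlocks₁₂ =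
    B.toBlocks₁₂.submatrix id e := rfl
  have h21 : (B.submatrix (Sum.map id e) (Sum.map id e)).toBlocks₂₁ =
    B.toBlocks₂₁.submatrix e id := rfl
  have h11 : (B.submatrix (Sum.map id e) (Sum.map id e)).toBlocks₁₁ = B.toBlocks₁₁ := rfl
  unfold SchurIdentity
  rw [h22, h12, h21, h11, det_submatrix_equiv_self, adjugate_submatrix_equiv_self,
    submatrix_mul_equiv, submatrix_mul_equiv, submatrix_id_id]
  exact H

theorem schurIdentity_iff_of_field {L : Type*} [Field L] {B : Matrix (Fin k ⊕ κ) (Fin k ⊕ κ) L}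
    {R : Matrix (Fin k) (Fin k) L} {q : L} (hq : q ≠ 0) (hB : B.toBlocks₂₂.det ≠ 0) :
    SchurIdentity B (q • R) q ↔
      R = B.toBlocks₁₁ - B.toBlocks₁₂ * B.toBlocks₂₂⁻¹ * B.toBlocks₂₁ := by
  have h : B.toBlocks₂₂.det • B.toBlocks₁₁ -
      B.toBlocks₁₂ * B.toBlocks₂₂.adjugate * B.toBlocks₂₁ =
      B.toBlocks₂₂.det • (B.toBlocks₁₁ - B.toBlocks₁₂ * B.toBlocks₂₂⁻¹ * B.toBlocks₂₁) := by
    rw [Matrix.inv_def, Ring.inverse_eq_inv', smul_sub, Matrix.mul_smul, Matrix.smul_mul,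
      smul_smul, mul_inv_cancel₀ hB, one_smul]
  unfold SchurIdentity
  rw [h, smul_comm]
  exact ((smul_right_injective _ hq).eq_iff).trans ((smul_right_injective _ hB).eq_iff)

end SchurIdentity

/-! ### The four kinds of realization treated uniformly -/

section FlaggedRealization

variable {F : Type*} [Field F] {n k : ℕ}

/-- A Bessmertnyĭ realization that is symmetric if `s` and homogeneous if `h`. -/
def HasRealization (s h : Prop) (R : Matrix (Fin k) (Fin k) (RatFun n F)) : Prop :=
  ∃ p : ℕ, 0 < p ∧ ∃ (A₀ : Matrix (Fin k ⊕ Fin p) (Fin k ⊕ Fin p) F)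
    (A : Fin n → Matrix (Fin k ⊕ Fin p) (Fin k ⊕ Fin p) F),
      CoeffCond s h A₀ A ∧ IsSchurComplement (linearPencil A₀ A) R

theorem hasBR_iff (R : Matrix (Fin k) (Fin k) (RatFun n F)) :
    HasBR R ↔ HasRealization False False R := by
  constructor
  · rintro ⟨p, hp, _, ⟨A₀, A, rfl⟩, H⟩
    exact ⟨p, hp, A₀, A, ⟨False.elim, False.elim⟩, H⟩
  · rintro ⟨p, hp, A₀, A, -, H⟩
    exact ⟨p, hp, _, ⟨A₀, A, rfl⟩, H⟩

theorem hasSBR_iff (R : Matrix (Fin k) (Fin k) (RatFun n F)) :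
    HasSBR R ↔ HasRealization True False R := by
  constructor
  · rintro ⟨p, hp, _, ⟨A₀, A, h₀, hA, rfl⟩, H⟩
    exact ⟨p, hp, A₀, A, ⟨fun _ => ⟨h₀, hA⟩, False.elim⟩, H⟩
  · rintro ⟨p, hp, A₀, A, hc, H⟩
    exact ⟨p, hp, _, ⟨A₀, A, (hc.1 trivial).1, (hc.1 trivial).2, rfl⟩, H⟩

theorem hasHBR_iff (R : Matrix (Fin k) (Fin k) (RatFun n F)) :
    HasHBR R ↔ HasRealization False True R := by
  constructor
  · rintro ⟨p, hp, _, ⟨A, rfl⟩, H⟩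
    exact ⟨p, hp, 0, A, ⟨False.elim, fun _ => rfl⟩, H⟩
  · rintro ⟨p, hp, A₀, A, hc, H⟩
    obtain rfl := hc.2 trivial
    exact ⟨p, hp, _, ⟨A, rfl⟩, H⟩

theorem hasHSBR_iff (R : Matrix (Fin k) (Fin k) (RatFun n F)) :
    HasHSBR R ↔ HasRealization True True R := by
  constructor
  · rintro ⟨p, hp, _, ⟨A, hA, rfl⟩, H⟩
    exact ⟨p, hp, 0, A, ⟨fun _ => ⟨Matrix.transpose_zero, hA⟩, fun _ => rfl⟩, H⟩
  · rintro ⟨p, hp, A₀, A, hc, H⟩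
    obtain rfl := hc.2 trivial
    exact ⟨p, hp, _, ⟨A, (hc.1 trivial).2, rfl⟩, H⟩

theorem exists_common_denominator (R : Matrix (Fin k) (Fin k) (RatFun n F)) :
    ∃ (q : MvPolynomial (Fin n) F) (P : Matrix (Fin k) (Fin k) (MvPolynomial (Fin n) F)),
      q ≠ 0 ∧ P.map (algebraMap _ (RatFun n F)) = algebraMap _ (RatFun n F) q • R := by
  obtain ⟨b, hb⟩ := IsLocalization.exist_integer_multiples_of_finite
    (nonZeroDivisors (MvPolynomial (Fin n) F)) (fun x : Fin k × Fin k => R x.1 x.2)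
  choose P hP using hb
  refine ⟨b, Matrix.of fun i j => P (i, j), nonZeroDivisors.ne_zero b.2, ?_⟩
  ext1 i j
  simpa [Algebra.smul_def] using hP (i, j)

theorem isSchurComplement_iff {p : ℕ}
    (B : Matrix (Fin k ⊕ Fin p) (Fin k ⊕ Fin p) (MvPolynomial (Fin n) F))
    (R : Matrix (Fin k) (Fin k) (RatFun n F)) {q : MvPolynomial (Fin n) F} (hq : q ≠ 0) :
    IsSchurComplement B R ↔ B.toBlocks₂₂.det ≠ 0 ∧
      SchurIdentity (B.map (algebraMap _ (RatFun n F))) (algebraMap _ (RatFun n F) q • R)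
        (algebraMap _ (RatFun n F) q) := by
  have hinj := IsFractionRing.injective (MvPolynomial (Fin n) F) (RatFun n F)
  have hq' : algebraMap _ (RatFun n F) q ≠ 0 := (map_ne_zero_iff _ hinj).2 hq
  have hu : IsUnit (B.map (algebraMap _ (RatFun n F))).toBlocks₂₂ ↔ B.toBlocks₂₂.det ≠ 0 := by
    rw [Matrix.isUnit_iff_isUnit_det, isUnit_iff_ne_zero, det_toBlocks₂₂_map,
      map_ne_zero_iff _ hinj]
  unfold IsSchurComplement
  refine and_congr_right_iff.2 (fun hB => ?_) |>.trans (and_congr_left' hu)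
  refine (schurIdentity_iff_of_field hq' ?_).symm
  rwa [Matrix.isUnit_iff_isUnit_det, isUnit_iff_ne_zero] at hB

end FlaggedRealization

/-! ### Polynomial realizations over an F-algebra -/

section PolynomialRealization

variable {F : Type*} [Field F] {n k : ℕ}

/-- Denominator-free realization of `q⁻¹ P` by a pencil with coefficients in an `F`-algebra. -/
def HasPolyRealization (S : Type*) [CommRing S] [Algebra F S] (κ : Type*) [Fintype κ]
    [DecidableEq κ] (s h : Prop) (P : Matrix (Fin k) (Fin k) (MvPolynomial (Fin n) F))
    (q : MvPolynomial (Fin n) F) : Prop :=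
  ∃ (A₀ : Matrix (Fin k ⊕ κ) (Fin k ⊕ κ) S) (A : Fin n → Matrix (Fin k ⊕ κ) (Fin k ⊕ κ) S),
    CoeffCond s h A₀ A ∧ (linearPencil A₀ A).toBlocks₂₂.det ≠ 0 ∧
      SchurIdentity (linearPencil A₀ A) (P.map (MvPolynomial.map (algebraMap F S)))
        (MvPolynomial.map (algebraMap F S) q)

theorem HasPolyRealization.hasRealization {κ : Type*} [Fintype κ] [DecidableEq κ] [Nonempty κ]
    {s h : Prop} {P : Matrix (Fin k) (Fin k) (MvPolynomial (Fin n) F)}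
    {q : MvPolynomial (Fin n) F} (H : HasPolyRealization F κ s h P q) (hq : q ≠ 0)
    {R : Matrix (Fin k) (Fin k) (RatFun n F)}
    (hR : P.map (algebraMap _ (RatFun n F)) = algebraMap _ (RatFun n F) q • R) :
    HasRealization s h R := by
  obtain ⟨A₀, A, hc, hdet, hs⟩ := H
  have hP : P.map (MvPolynomial.map (algebraMap F F)) = P := by
    ext1 i j
    rw [Matrix.map_apply, Algebra.algebraMap_self, MvPolynomial.map_id]
  rw [hP, Algebra.algebraMap_self, MvPolynomial.map_id] at hs
  have e := (Fintype.equivFin κ).symm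
  refine ⟨Fintype.card κ, Fintype.card_pos, _, _, hc.submatrix (Sum.map id e), ?_⟩
  rw [isSchurComplement_iff _ _ hq, ← linearPencil_submatrix, ← hR]
  refine ⟨?_, (hs.reindex e).map _⟩
  change ((linearPencil A₀ A).toBlocks₂₂.submatrix e e).det ≠ 0
  rwa [det_submatrix_equiv_self]

end PolynomialRealization

/-! ### Absorbing the extra variables into the scalars -/

section Extension

variable {F K : Type*} [Field F] [Field K] [Algebra F K] {n N : ℕ}

/-- The substitution `K[z₁, …, z_N] → K(z₁, …, z_N)[z₁, …, zₙ]` which keeps `z₁, …, zₙ` and sends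
every other `zⱼ` to `(zⱼ / z₁) z₁`, the first factor being a scalar. -/
def scaleExtraVars (K : Type*) [Field K] (n N : ℕ) [NeZero n] [NeZero N] :
    MvPolynomial (Fin N) K →+* MvPolynomial (Fin n) (RatFun N K) :=
  MvPolynomial.eval₂Hom (MvPolynomial.C.comp (algebraMap K (RatFun N K))) fun j =>
    if hj : (j : ℕ) < n then MvPolynomial.X ⟨j, hj⟩
    else MvPolynomial.X 0 * MvPolynomial.C (algebraMap _ _ (MvPolynomial.X j : MvPolynomial (Fin N) K) /
      algebraMap _ _ (MvPolynomial.X 0 : MvPolynomial (Fin N) K))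

/-- Evaluating the remaining variables at z₁, …, zₙ in K(w) undoes the substitution, since
(z_j/z₁)z₁ = z_j there. -/
theorem scaleExtraVars_injective [NeZero n] [NeZero N] (h : n ≤ N) :
    Function.Injective (scaleExtraVars K n N) := by
  have h0 : algebraMap _ (RatFun N K) (MvPolynomial.X 0 : MvPolynomial (Fin N) K) ≠ 0 :=
    (map_ne_zero_iff _ (IsFractionRing.injective _ _)).2 (MvPolynomial.X_ne_zero 0)
  have hcomp : (MvPolynomial.eval fun i : Fin n =>
      algebraMap _ (RatFun N K) (MvPolynomial.X (Fin.castLE h i) : MvPolynomial (Fin N) K)).comp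
        (scaleExtraVars K n N) = algebraMap _ _ := by
    refine MvPolynomial.ringHom_ext (fun a => ?_) (fun j => ?_)
    · simp [scaleExtraVars, IsScalarTower.algebraMap_apply K (MvPolynomial (Fin N) K) (RatFun N K),
        MvPolynomial.algebraMap_eq]
    · by_cases hj : (j : ℕ) < n
      · simp [scaleExtraVars, hj]
      · have : Fin.castLE h 0 = 0 := rfl
        simp [scaleExtraVars, hj, this, mul_div_cancel₀ _ h0]
  have hinj := IsFractionRing.injective (MvPolynomial (Fin N) K) (RatFun N K)
  rw [← hcomp, RingHom.coe_comp] at hinj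
  exact Function.Injective.of_comp hinj

theorem scaleExtraVars_comp_polyIncl [NeZero n] [NeZero N] (h : n ≤ N) :
    (scaleExtraVars K n N).comp (polyIncl F K h) =
      MvPolynomial.map (algebraMap F (RatFun N K)) := by
  refine MvPolynomial.ringHom_ext (fun a => ?_) (fun j => ?_)
  · simp [scaleExtraVars, polyIncl, IsScalarTower.algebraMap_apply F K (RatFun N K)]
  · simp [scaleExtraVars, polyIncl]

/-- Every variable goes to a linear form without constant term, so A₀ is unchanged and the new
coefficients are linear combinations of the old. -/
theorem scaleExtraVars_linearPencil [NeZero n] [NeZero N] {ι : Type*}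
    {s h : Prop} {A₀ : Matrix ι ι K} {A : Fin N → Matrix ι ι K} (hc : CoeffCond s h A₀ A) :
    ∃ (B₀ : Matrix ι ι (RatFun N K)) (B : Fin n → Matrix ι ι (RatFun N K)),
      CoeffCond s h B₀ B ∧
        (linearPencil A₀ A).map (scaleExtraVars K n N) = linearPencil B₀ B := by
  let c : Fin n → Fin N → RatFun N K := fun i j =>
    if hj : (j : ℕ) < n then if i = ⟨j, hj⟩ then 1 else 0
    else if i = 0 then algebraMap _ _ (MvPolynomial.X j : MvPolynomial (Fin N) K) /
      algebraMap _ _ (MvPolynomial.X 0 : MvPolynomial (Fin N) K) else 0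
  have hX (j : Fin N) : scaleExtraVars K n N (MvPolynomial.X j) =
      ∑ i, MvPolynomial.X i * MvPolynomial.C (c i j) := by
    by_cases hj : (j : ℕ) < n <;>
      simp [scaleExtraVars, c, hj, apply_ite MvPolynomial.C]
  have hC (a : K) : scaleExtraVars K n N (MvPolynomial.C a) =
      MvPolynomial.C (algebraMap K _ a) := by simp [scaleExtraVars]
  refine ⟨A₀.map (algebraMap K _), fun i => ∑ j, c i j • (A j).map (algebraMap K _),
    ⟨fun hs => ⟨(hc.1 hs).1.map _, fun i => ?_⟩, fun hh => (hc.map (algebraMap K _)).2 hh⟩, ?_⟩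
  · rw [Matrix.IsSymm, Matrix.transpose_sum]
    refine Finset.sum_congr rfl fun j _ => ?_
    rw [Matrix.transpose_smul, (((hc.1 hs).2 j).map _).eq]
  · ext1 x y
    simp only [Matrix.map_apply, linearPencil_apply, map_add, map_sum, map_mul, hX, hC,
      Matrix.sum_apply, Matrix.smul_apply, smul_eq_mul, Finset.sum_mul, Finset.mul_sum]
    rw [Finset.sum_comm]
    simp only [mul_assoc]

theorem HasRealization.hasPolyRealization {s h : Prop} [NeZero n] (hnN : n ≤ N) {k : ℕ}
    {R : Matrix (Fin k) (Fin k) (RatFun n F)} (H : HasRealization s h (R.map (ratIncl F K hnN)))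
    {P : Matrix (Fin k) (Fin k) (MvPolynomial (Fin n) F)} {q : MvPolynomial (Fin n) F}
    (hq : q ≠ 0) (hR : P.map (algebraMap _ (RatFun n F)) = algebraMap _ (RatFun n F) q • R) :
    ∃ p : ℕ, 0 < p ∧ HasPolyRealization (RatFun N K) (Fin p) s h P q := by
  have : NeZero N := ⟨fun h0 => NeZero.ne n (by omega)⟩
  obtain ⟨p, hp, A₀, A, hc, hS⟩ := H
  have hq' : polyIncl F K hnN q ≠ 0 := (map_ne_zero_iff _ (polyIncl_injective F K hnN)).2 hq
  have hincl (f : MvPolynomial (Fin n) F) : ratIncl F K hnN (algebraMap _ _ f) =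
      algebraMap _ (RatFun N K) (polyIncl F K hnN f) :=
    IsLocalization.map_eq (M := nonZeroDivisors (MvPolynomial (Fin n) F))
      (nonZeroDivisors_le_comap_nonZeroDivisors_of_injective _ (polyIncl_injective F K hnN)) f
  rw [isSchurComplement_iff _ _ hq'] at hS
  have hR' : algebraMap _ (RatFun N K) (polyIncl F K hnN q) • R.map (ratIncl F K hnN) =
      (P.map (polyIncl F K hnN)).map (algebraMap _ (RatFun N K)) := by
    ext1 i j
    have := congrArg (ratIncl F K hnN) (congrFun (congrFun hR i) j)
    simp only [Matrix.map_apply, Matrix.smul_apply, smul_eq_mul, map_mul, hincl] at this ⊢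
    exact this.symm
  rw [hR'] at hS
  obtain ⟨B₀, B, hcB, hB⟩ := scaleExtraVars_linearPencil (n := n) hc
  refine ⟨p, hp, B₀, B, hcB, ?_, ?_⟩
  · rw [← hB, det_toBlocks₂₂_map, map_ne_zero_iff _ (scaleExtraVars_injective hnN)]
    exact hS.1
  -- The identity is pulled back from K(w) to K[w], where the substitution is defined.
  · have := (SchurIdentity.of_map (IsFractionRing.injective _ _) hS.2).map (scaleExtraVars K n N)
    rw [hB, Matrix.map_map, ← RingHom.coe_comp, ← RingHom.comp_apply,
      scaleExtraVars_comp_polyIncl] at this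
    exact this

end Extension

/-! ### Specialization to a finite extension -/

section Specialization

variable {F : Type*} [Field F] {n k : ℕ}

theorem HasPolyRealization.exists_finite {E : Type*} [Field E] [Algebra F E] {κ : Type*}
    [Fintype κ] [DecidableEq κ] {s h : Prop}
    {P : Matrix (Fin k) (Fin k) (MvPolynomial (Fin n) F)} {q : MvPolynomial (Fin n) F}
    (H : HasPolyRealization E κ s h P q) :
    ∃ (S : Subalgebra F E) (m : Ideal S) (_ : m.IsMaximal), Module.Finite F (S ⧸ m) ∧
      HasPolyRealization (S ⧸ m) κ s h P q := by
  obtain ⟨A₀, A, hc, hdet, hs⟩ := H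
  obtain ⟨d, hd⟩ := MvPolynomial.ne_zero_iff.1 hdet
  set c := MvPolynomial.coeff d (linearPencil A₀ A).toBlocks₂₂.det with hcdef
  -- Adjoining c⁻¹ makes the coefficient c of det B₂₂ a unit, so the determinant stays nonzero
  -- modulo any maximal ideal.
  let G : Set E := {c⁻¹} ∪ (Set.range fun x : (Fin k ⊕ κ) × (Fin k ⊕ κ) => A₀ x.1 x.2) ∪
    Set.range fun x : Fin n × (Fin k ⊕ κ) × (Fin k ⊕ κ) => A x.1 x.2.1 x.2.2
  have hG : G.Finite :=
    ((Set.finite_singleton _).union (Set.finite_range _)).union (Set.finite_range _)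
  let S := Algebra.adjoin F G
  have hcS : c⁻¹ ∈ S := Algebra.subset_adjoin (Or.inl (Or.inl rfl))
  let A₀' : Matrix (Fin k ⊕ κ) (Fin k ⊕ κ) S := fun x y =>
    ⟨A₀ x y, Algebra.subset_adjoin (Or.inl (Or.inr ⟨(x, y), rfl⟩))⟩
  let A' : Fin n → Matrix (Fin k ⊕ κ) (Fin k ⊕ κ) S := fun i x y =>
    ⟨A i x y, Algebra.subset_adjoin (Or.inr ⟨(i, x, y), rfl⟩)⟩
  have hc' : CoeffCond s h A₀' A' := by
    refine ⟨fun hs' => ⟨?_, fun i => ?_⟩, fun hh => ?_⟩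
    · ext x y
      exact congrFun (congrFun (hc.1 hs').1 x) y
    · ext x y
      exact congrFun (congrFun ((hc.1 hs').2 i) x) y
    · ext x y
      exact congrFun (congrFun (hc.2 hh) x) y
  let v : S →+* E := S.val.toRingHom
  have hv : Function.Injective v := Subtype.val_injective
  have hpen : (linearPencil A₀' A').map (MvPolynomial.map v) = linearPencil A₀ A := by
    rw [linearPencil_map]
    rfl
  have hs' : SchurIdentity (linearPencil A₀' A') (P.map (MvPolynomial.map (algebraMap F S)))
      (MvPolynomial.map (algebraMap F S) q) := by
    refine SchurIdentity.of_map (MvPolynomial.map_injective v hv) ?_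
    rw [hpen, Matrix.map_map, MvPolynomial.map_map]
    simp only [Function.comp_def, MvPolynomial.map_map]
    exact hs
  let c' : S := MvPolynomial.coeff d (linearPencil A₀' A').toBlocks₂₂.det
  have hc'c : v c' = c := by
    rw [hcdef, ← hpen, det_toBlocks₂₂_map, MvPolynomial.coeff_map]
  have hunit : c' * ⟨c⁻¹, hcS⟩ = 1 := by
    refine hv ?_
    rw [map_mul, hc'c, map_one]
    exact mul_inv_cancel₀ hd
  obtain ⟨m, hm⟩ := Ideal.exists_maximal S
  let _ := Ideal.Quotient.field m
  have : Algebra.FiniteType F S :=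
    S.fg_iff_finiteType.1 (by simpa [S] using Subalgebra.fg_adjoin_finset (R := F) hG.toFinset)
  let f : S →+* S ⧸ m := Ideal.Quotient.mk m
  have hpenf : (linearPencil A₀' A').map (MvPolynomial.map f) =
    linearPencil (A₀'.map f) (fun i => (A' i).map f) := linearPencil_map _ _ _
  refine ⟨S, m, hm, finite_of_finite_type_of_isJacobsonRing F (S ⧸ m), A₀'.map f,
    fun i => (A' i).map f, hc'.map f, ?_, ?_⟩
  · rw [← hpenf, det_toBlocks₂₂_map]
    refine MvPolynomial.ne_zero_iff.2 ⟨d, ?_⟩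
    rw [MvPolynomial.coeff_map]
    intro h0
    have := congrArg f hunit
    rw [map_mul, map_one, h0, zero_mul] at this
    exact zero_ne_one this
  · have := hs'.map (MvPolynomial.map f)
    rw [hpenf, Matrix.map_map, MvPolynomial.map_map] at this
    simp only [Function.comp_def, MvPolynomial.map_map] at this
    exact this

end Specialization

/-! ### Descent along a finite extension by a linear form -/

section FiniteDescent

variable {F E : Type*} [Field F] [Field E] [Algebra F E] {n k : ℕ}

/-- The coefficientwise extension of an `F`-linear form `E → F` to polynomials. -/
def polyForm (l : E →ₗ[F] F) : MvPolynomial (Fin n) E →+ MvPolynomial (Fin n) F where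
  toFun f := AddMonoidAlgebra.map l.toAddMonoidHom f
  map_zero' := by
    ext d
    exact l.map_zero
  map_add' f g := by
    ext d
    exact l.map_add _ _

theorem coeff_polyForm (l : E →ₗ[F] F) (f : MvPolynomial (Fin n) E) (d : Fin n →₀ ℕ) :
    (polyForm l f).coeff d = l (f.coeff d) := rfl

theorem polyForm_map_mul (l : E →ₗ[F] F) (g : MvPolynomial (Fin n) F)
    (f : MvPolynomial (Fin n) E) :
    polyForm l (MvPolynomial.map (algebraMap F E) g * f) = g * polyForm l f := by
  ext d
  simp only [coeff_polyForm, MvPolynomial.coeff_mul, MvPolynomial.coeff_map, map_sum,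
    ← Algebra.smul_def, map_smul, smul_eq_mul]

theorem polyForm_map (l : E →ₗ[F] F) (hl : l 1 = 1) (g : MvPolynomial (Fin n) F) :
    polyForm l (MvPolynomial.map (algebraMap F E) g) = g := by
  ext d
  rw [coeff_polyForm, MvPolynomial.coeff_map, Algebra.algebraMap_eq_smul_one, map_smul, hl,
    smul_eq_mul, mul_one]

theorem polyForm_C (l : E →ₗ[F] F) (a : E) :
    polyForm l (MvPolynomial.C a : MvPolynomial (Fin n) E) = MvPolynomial.C (l a) := by
  ext d
  rw [coeff_polyForm, MvPolynomial.coeff_C, MvPolynomial.coeff_C]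
  split_ifs
  · rfl
  · exact l.map_zero

/-- Nondegeneracy of l(xy): if e ≠ 0 is a coefficient of f, then l(xe) vanishes on a basis, hence
for all x, yet x = e⁻¹ gives l(1) = 1. -/
theorem eq_zero_of_polyForm_basis {α : Type*} (b : Module.Basis α F E) {l : E →ₗ[F] F}
    (hl : l 1 = 1) {f : MvPolynomial (Fin n) E}
    (hf : ∀ a, polyForm l (MvPolynomial.C (b a) * f) = 0) : f = 0 := by
  ext d
  rw [MvPolynomial.coeff_zero]
  by_contra hd
  have h0 : l ∘ₗ LinearMap.mulRight F (f.coeff d) = 0 := by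
    refine b.ext fun a => ?_
    have := congrArg (MvPolynomial.coeff d) (hf a)
    rwa [coeff_polyForm, MvPolynomial.coeff_C_mul] at this
  have h1 := LinearMap.congr_fun h0 (f.coeff d)⁻¹
  rw [LinearMap.comp_apply, LinearMap.mulRight_apply, inv_mul_cancel₀ hd, hl] at h1
  exact one_ne_zero h1

variable {κ α : Type*}

/-- Row index below a row of the descended matrix. -/
def rowOf : Fin k ⊕ κ × α → Fin k ⊕ κ := Sum.map id Prod.fst

/-- Weight of a row of the descended matrix. -/
def weightOf (b : α → E) : Fin k ⊕ κ × α → E := Sum.elim (fun _ => 1) (fun x => b x.2)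

/-- The matrix over `F` of the bilinear form `l (xᵀ M y)`, restricted to the `F`-span of the first
`k` coordinate vectors and the `E`-span of the others. -/
def descend (l : E →ₗ[F] F) (b : α → E) (M : Matrix (Fin k ⊕ κ) (Fin k ⊕ κ) E) :
    Matrix (Fin k ⊕ κ × α) (Fin k ⊕ κ × α) F :=
  fun x y => l (weightOf b x * weightOf b y * M (rowOf x) (rowOf y))

theorem descend_linearPencil (l : E →ₗ[F] F) (b : α → E)
    (A₀ : Matrix (Fin k ⊕ κ) (Fin k ⊕ κ) E) (A : Fin n → Matrix (Fin k ⊕ κ) (Fin k ⊕ κ) E)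
    (x y : Fin k ⊕ κ × α) :
    linearPencil (descend l b A₀) (fun i => descend l b (A i)) x y =
      polyForm l (MvPolynomial.C (weightOf b x) * (MvPolynomial.C (weightOf b y) *
        linearPencil A₀ A (rowOf x) (rowOf y))) := by
  have hX (i : Fin n) (a : E) : polyForm l (MvPolynomial.X i * MvPolynomial.C a) =
      MvPolynomial.X i * MvPolynomial.C (l a) := by
    rw [← polyForm_C, ← polyForm_map_mul, MvPolynomial.map_X]
  simp only [linearPencil_apply, mul_add, Finset.mul_sum, map_add, map_sum, descend]
  congr 1
  · rw [← MvPolynomial.C_mul, ← MvPolynomial.C_mul, polyForm_C, mul_assoc]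
  · refine Finset.sum_congr rfl fun i _ => ?_
    rw [← hX, mul_assoc, MvPolynomial.C_mul, MvPolynomial.C_mul]
    congr 1
    ring

theorem CoeffCond.descend {s h : Prop} {A₀ : Matrix (Fin k ⊕ κ) (Fin k ⊕ κ) E}
    {A : Fin n → Matrix (Fin k ⊕ κ) (Fin k ⊕ κ) E} (H : CoeffCond s h A₀ A)
    (l : E →ₗ[F] F) (b : α → E) :
    CoeffCond s h (descend l b A₀) (fun i => Bessmertnyi.descend l b (A i)) := by
  have key {M : Matrix (Fin k ⊕ κ) (Fin k ⊕ κ) E} (hM : M.IsSymm) :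
      (Bessmertnyi.descend l b M).IsSymm := by
    refine Matrix.IsSymm.ext fun x y => ?_
    unfold Bessmertnyi.descend
    rw [hM.apply, mul_comm (weightOf b y)]
  refine ⟨fun hs => ⟨key (H.1 hs).1, fun i => key ((H.1 hs).2 i)⟩, fun hh => ?_⟩
  rw [H.2 hh]
  ext x y
  simp [Bessmertnyi.descend]

variable [Fintype α]

/-- The vector over `E[z]` with the given coordinates over `F[z]`. -/
def combine (b : α → E) {r : Type*} (X : Matrix (κ × α) r (MvPolynomial (Fin n) F)) :
    Matrix κ r (MvPolynomial (Fin n) E) :=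
  fun j t => ∑ a, MvPolynomial.map (algebraMap F E) (X (j, a) t) * MvPolynomial.C (b a)

theorem combine_eq_zero (b : Module.Basis α F E) {r : Type*}
    {X : Matrix (κ × α) r (MvPolynomial (Fin n) F)} (h : combine b X = 0) : X = 0 := by
  ext ⟨j, a⟩ t d
  have h1 := congrArg (MvPolynomial.coeff d) (congrFun (congrFun h j) t)
  simp only [combine, MvPolynomial.coeff_sum] at h1
  refine Fintype.linearIndependent_iff.1 b.linearIndependent
    (fun a => (X (j, a) t).coeff d) (Eq.trans (Finset.sum_congr rfl fun a _ => ?_) h1) a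
  rw [mul_comm, MvPolynomial.coeff_C_mul, MvPolynomial.coeff_map, Algebra.smul_def, mul_comm]

/-- Multiplying by the descended matrix amounts to assembling coordinates into a vector over E[z],
multiplying over E[z], and applying l. -/
theorem polyForm_mul_combine [Fintype κ] (l : E →ₗ[F] F) (b : α → E) {r : Type*}
    (X : Matrix (κ × α) r (MvPolynomial (Fin n) F)) (M : κ → MvPolynomial (Fin n) E)
    (w : MvPolynomial (Fin n) E) (t : r) :
    polyForm l (w * ∑ j, M j * combine b X j t) =
      ∑ y : κ × α, polyForm l (w * (MvPolynomial.C (b y.2) * M y.1)) * X y t := by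
  rw [Fintype.sum_prod_type]
  simp only [combine, Finset.mul_sum, map_sum]
  refine Finset.sum_congr rfl fun j _ => Finset.sum_congr rfl fun a _ => ?_
  rw [mul_comm _ (X (j, a) t), ← polyForm_map_mul]
  congr 1
  ring

theorem HasPolyRealization.descend [Fintype κ] [DecidableEq κ] [Module.Finite F E] {s h : Prop}
    {P : Matrix (Fin k) (Fin k) (MvPolynomial (Fin n) F)} {q : MvPolynomial (Fin n) F}
    (H : HasPolyRealization E κ s h P q) :
    HasPolyRealization F (κ × Fin (Module.finrank F E)) s h P q := by
  obtain ⟨A₀, A, hc, hdet, hs⟩ := H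
  -- Any F-linear retraction of E onto F serves; the trace could vanish on an inseparable extension.
  obtain ⟨l, hl'⟩ := (Algebra.linearMap F E).exists_leftInverse_of_injective
    (LinearMap.ker_eq_bot.2 (algebraMap F E).injective)
  have hl : l 1 = 1 := by simpa using LinearMap.congr_fun hl' 1
  let b := Module.finBasis F E
  set M := linearPencil A₀ A with hM
  set B := linearPencil (Bessmertnyi.descend l b A₀) (fun i => Bessmertnyi.descend l b (A i))
    with hB
  have hBM (x y) : B x y = polyForm l (MvPolynomial.C (weightOf b x) *
      (MvPolynomial.C (weightOf b y) * M (rowOf x) (rowOf y))) :=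
    descend_linearPencil l b A₀ A x y
  have hB11 (i j) : B.toBlocks₁₁ i j = polyForm l (M.toBlocks₁₁ i j) := by
    simp [toBlocks₁₁, hBM, weightOf, rowOf]
  have hB21 (i a j) : B.toBlocks₂₁ (i, a) j =
      polyForm l (MvPolynomial.C (b a) * M.toBlocks₂₁ i j) := by
    simp [toBlocks₂₁, hBM, weightOf, rowOf]
  have hB12 {r : Type} (X : Matrix (κ × _) r (MvPolynomial (Fin n) F)) (i t) :
      (B.toBlocks₁₂ * X) i t = polyForm l ((M.toBlocks₁₂ * combine b X) i t) := by
    have := polyForm_mul_combine l b X (M.toBlocks₁₂ i) 1 t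
    rw [one_mul] at this
    simp only [Matrix.mul_apply]
    rw [this]
    simp [toBlocks₁₂, hBM, weightOf, rowOf]
  have hB22 {r : Type} (X : Matrix (κ × _) r (MvPolynomial (Fin n) F)) (i a t) :
      (B.toBlocks₂₂ * X) (i, a) t =
        polyForm l (MvPolynomial.C (b a) * (M.toBlocks₂₂ * combine b X) i t) := by
    simp only [Matrix.mul_apply]
    rw [polyForm_mul_combine]
    simp [toBlocks₂₂, hBM, weightOf, rowOf]
  -- By nondegeneracy, a kernel vector of B₂₂ assembles into one of M₂₂.
  have hBdet : B.toBlocks₂₂.det ≠ 0 := by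
    intro h0
    obtain ⟨v, hv, hv0⟩ := Matrix.exists_mulVec_eq_zero_iff.2 h0
    let X : Matrix (κ × Fin (Module.finrank F E)) Unit (MvPolynomial (Fin n) F) := fun y _ => v y
    have hX : B.toBlocks₂₂ * X = 0 := by
      ext1 y t
      exact congrFun hv0 y
    have hMX : M.toBlocks₂₂ * combine b X = 0 := by
      ext1 i t
      refine eq_zero_of_polyForm_basis b hl fun a => ?_
      rw [← hB22, hX]
      rfl
    have h2 : M.toBlocks₂₂.det • combine b X = 0 := by
      rw [← Matrix.one_mul (combine b X), ← Matrix.smul_mul, ← Matrix.adjugate_mul,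
        Matrix.mul_assoc, hMX, Matrix.mul_zero]
    have hX0 := combine_eq_zero b ((smul_eq_zero.1 h2).resolve_left hdet)
    exact hv (funext fun y => congrFun (congrFun hX0 y) ())
  refine ⟨_, _, hc.descend l b, hBdet, ?_⟩
  have hP : P.map (MvPolynomial.map (algebraMap F F)) = P := by
    ext1 i j
    rw [Matrix.map_apply, Algebra.algebraMap_self, MvPolynomial.map_id]
  rw [hP, Algebra.algebraMap_self, MvPolynomial.map_id, ← hB]
  set D := B.toBlocks₂₂.det with hD
  set D' := MvPolynomial.map (algebraMap F E) D with hD'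
  set q' := MvPolynomial.map (algebraMap F E) q with hq'
  let X := B.toBlocks₂₂.adjugate * B.toBlocks₂₁
  have hX : B.toBlocks₂₂ * X = D • B.toBlocks₂₁ := by
    rw [← Matrix.mul_assoc, Matrix.mul_adjugate, Matrix.smul_mul, Matrix.one_mul]
  let U := combine b X
  -- The system solved over F[z] by X holds over E[z] for U, as its two sides agree under every
  -- l(b_a ·).
  have hU : M.toBlocks₂₂ * U = D' • M.toBlocks₂₁ := by
    rw [← sub_eq_zero]
    ext1 i t
    refine eq_zero_of_polyForm_basis b hl fun a => ?_
    rw [Matrix.sub_apply, mul_sub, map_sub, ← hB22, hX, Matrix.smul_apply, Matrix.smul_apply,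
      hB21, smul_eq_mul, smul_eq_mul, mul_left_comm, polyForm_map_mul, sub_self]
  have hdU : M.toBlocks₂₂.det • (M.toBlocks₁₂ * U) =
      D' • (M.toBlocks₁₂ * M.toBlocks₂₂.adjugate * M.toBlocks₂₁) := by
    rw [← Matrix.mul_smul, ← Matrix.one_mul U, ← Matrix.smul_mul, ← Matrix.adjugate_mul,
      Matrix.mul_assoc, hU, Matrix.mul_smul, Matrix.mul_smul, Matrix.mul_assoc]
  -- With det M₂₂ cancelled, q, D and P all come from F[z], so applying l entrywise gives the
  -- identity for B.
  have hE : q' • (D' • M.toBlocks₁₁ - M.toBlocks₁₂ * U) =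
      D' • P.map (MvPolynomial.map (algebraMap F E)) := by
    refine smul_right_injective _ hdet ?_
    change M.toBlocks₂₂.det • _ = M.toBlocks₂₂.det • _
    rw [smul_comm _ D', hs, smul_comm _ q', smul_sub, hdU, smul_comm _ D', ← smul_sub,
      smul_comm D' q']
  unfold SchurIdentity
  ext1 i j
  have h3 := congrArg (polyForm l) (congrFun (congrFun hE i) j)
  simp only [Matrix.smul_apply, Matrix.sub_apply, Matrix.map_apply, smul_eq_mul] at h3
  rw [polyForm_map_mul, polyForm_map_mul, map_sub, polyForm_map_mul, polyForm_map l hl,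
    ← hB12, ← hB11] at h3
  simp only [Matrix.smul_apply, Matrix.sub_apply, smul_eq_mul]
  rw [← h3, Matrix.mul_assoc]

end FiniteDescent

/-! ### Assembling the descent -/

section Descent

variable {F K : Type*} [Field F] [Field K] [Algebra F K] {n N k : ℕ}

theorem HasRealization.of_map_ratIncl {s h : Prop} (hn : 1 ≤ n) (hnN : n ≤ N)
    {R : Matrix (Fin k) (Fin k) (RatFun n F)}
    (H : HasRealization s h (R.map (ratIncl F K hnN))) : HasRealization s h R := by
  have : NeZero n := ⟨by omega⟩
  obtain ⟨q, P, hq, hR⟩ := exists_common_denominator R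
  obtain ⟨p, hp, H₁⟩ := H.hasPolyRealization hnN hq hR
  obtain ⟨S, m, hm, hfin, H₂⟩ := H₁.exists_finite
  let _ := Ideal.Quotient.field m
  have : Nonempty (Fin p) := ⟨⟨0, hp⟩⟩
  have : Nonempty (Fin (Module.finrank F (S ⧸ m))) := ⟨⟨0, Module.finrank_pos⟩⟩
  exact (HasPolyRealization.descend H₂).hasRealization hq hR

end Descent

end Bessmertnyi
end

theorem theorem1p5 {F K : Type*} [Field F] [Field K] [Algebra F K] {n N : ℕ}
    (hn : 1 ≤ n) (hnN : n ≤ N) {k : ℕ}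
    (R : Matrix (Fin k) (Fin k) (Bessmertnyi.RatFun n F)) :
    (Bessmertnyi.HasBR (R.map (Bessmertnyi.ratIncl F K hnN)) → Bessmertnyi.HasBR R) ∧
    (Bessmertnyi.HasSBR (R.map (Bessmertnyi.ratIncl F K hnN)) → Bessmertnyi.HasSBR R) ∧
    (Bessmertnyi.HasHBR (R.map (Bessmertnyi.ratIncl F K hnN)) → Bessmertnyi.HasHBR R) ∧
    (Bessmertnyi.HasHSBR (R.map (Bessmertnyi.ratIncl F K hnN)) → Bessmertnyi.HasHSBR R) := by
  simp only [Bessmertnyi.hasBR_iff, Bessmertnyi.hasSBR_iff, Bessmertnyi.hasHBR_iff,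
    Bessmertnyi.hasHSBR_iff]
  exact ⟨.of_map_ratIncl hn hnN, .of_map_ratIncl hn hnN, .of_map_ratIncl hn hnN,
    .of_map_ratIncl hn hnN⟩
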